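/- Let $L>m\ge 0$, and for $d\in\mathbb N$ let $q(x)=\tfrac12\|x\|^2$ on $\mathbb R^d$. Let $\mathcal S_{m,L}^0$ be the set of all $f:\mathbb R^d\to\mathbb R$ such that $f-mq$ and $Lq-f$ are convex, $f(0)=0$ and $\nabla f(0)=0$ (such $f$ are differentiable). Fix $\rho\in(0,1]$ and real matrices $A_a\in\mathbb R^{n\times n}$, $B_a\in\mathbb R^{n\times 1}$, $C_a\in\mathbb R^{1\times n}$. Fix also a real polynomial $\alpha(z)=\alpha_0+\alpha_1z+\dots+\alpha_{l-1}z^{l-1}+z^l$ of degree $l\ge 0$, all of whose complex roots lie in $\{z\in\mathbb C: |z|<\rho\}$ and whose coefficients satisfy $\alpha_0,\dots,\alpha_{l-1}\le 0$. Let $A_f=C_\alpha\in\mathbb R^{l\times l}$ be the companion matrix of $\alpha$ with ones on the superdiagonal and last row $(-\alpha_0,\dots,-\alpha_{l-1})$, and let $B_f=e_l\in\mathbb R^{l}$ be the last standard unit vector (for $l=0$ these matrices are empty). Suppose that there exist a symmetric matrix $\mathcal X\in\mathbb R^{(l+n)\times(l+n)}$ and $(C_f,D_f)\in\mathbb R^{1\times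 l}\times\mathbb R$ such that $$C_f\,(B_f,\ A_fB_f,\ \dots,\ A_f^{l-1}B_f)\le 0\ \text{ (entrywise)},\qquad D_f+C_f(\rho I-A_f)^{-1}B_f>0,$$ and such that, with $$\begin{pmatrix}\mathcal A&\mathcal B\\ \mathcal C&\mathcal D\end{pmatrix}:=\begin{pmatrix}A_f&B_f(L-m)C_a&-B_f\\ 0&\rho^{-1}(A_a+B_a\,m\,C_a)&\rho^{-1}B_a\\ C_f&D_f(L-m)C_a&-D_f\end{pmatrix},$$ one has $\mathcal X\succ 0$ and $$\begin{pmatrix}\mathcal A&\mathcal B\\ I&0\end{pmatrix}^{\!\top}\begin{pmatrix}\mathcal X&0\\0&-\mathcal X\end{pmatrix}\begin{pmatrix}\mathcal A&\mathcal B\\ I&0\end{pmatrix}+\begin{pmatrix}\mathcal C&\mathcal D\\0&1\end{pmatrix}^{\!\top}\begin{pmatrix}0&1\\1&0\end{pmatrix}\begin{pmatrix}\mathcal C&\mathcal D\\0&1\end{pmatrix}\prec 0 .$$ Then there exists a constant $K$ such that, for every dimension $d\in\mathbb N$ and every $f:\mathbb R^d\to\mathbb R$ in $\mathcal S^0_{m,L}$,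 all trajectories of the feedback loop $$x_{t+1}=(A_a\otimes I_d)x_t+(B_a\otimes I_d)w_t,\qquad z_t=(C_a\otimes I_d)x_t,\qquad w_t=\nabla f(z_t)\qquad(t=0,1,2,\dots)$$ satisfy $$\|x_t\|\le K\rho^t\|x_0\|\qquad\text{for all } t=0,1,2,\dots .$$ If $\rho=1$, then in addition $\lim_{t\to\infty}x_t=0$ for all these trajectories. -/

import Mathlib

open Matrix
open scoped Kronecker Topology

noncomputable section

namespace RobustOpt

/-! ### The function class -/

/-- The quadratic function `q x = ‖x‖² / 2`. -/
def halfSq {d : ℕ} (x : EuclideanSpace ℝ (Fin d)) : ℝ := (1 / 2 : ℝ) * ‖x‖ ^ 2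

/-- `f` belongs to the class `S_{m,L}`: both `f - m q` and `L q - f` are convex on `ℝ^d`. -/
def MemS (m L : ℝ) {d : ℕ} (f : EuclideanSpace ℝ (Fin d) → ℝ) : Prop :=
  ConvexOn ℝ Set.univ (fun x => f x - m * halfSq x) ∧
    ConvexOn ℝ Set.univ (fun x => L * halfSq x - f x)

/-- `f` belongs to the class `S⁰_{m,L}`: `f ∈ S_{m,L}`, `f 0 = 0` and `∇ f 0 = 0`. -/
def MemS0 (m L : ℝ) {d : ℕ} (f : EuclideanSpace ℝ (Fin d) → ℝ) : Prop :=
  MemS m L f ∧ f 0 = 0 ∧ gradient f 0 = 0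

/-! ### The feedback loop -/

/-- `(x, w, z)` is a trajectory of the loop
`x_{t+1} = (A ⊗ I_d) x_t + (B ⊗ I_d) w_t`, `z_t = (C ⊗ I_d) x_t`, `w_t = ∇ f (z_t)`, `t ∈ ℕ₀`.
A vector of `ℝ^{nd}` is indexed by `Fin n × Fin d`, as in Mathlib's Kronecker product; in the same
way a vector `v` of `ℝ^d` is read as the vector `fun k => v k.2` over `Fin 1 × Fin d`. -/
structure IsLoopTrajectory {n d : ℕ} (A : Matrix (Fin n) (Fin n) ℝ)
    (B : Matrix (Fin n) (Fin 1) ℝ) (C : Matrix (Fin 1) (Fin n) ℝ)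
    (f : EuclideanSpace ℝ (Fin d) → ℝ)
    (x : ℕ → EuclideanSpace ℝ (Fin n × Fin d)) (w z : ℕ → EuclideanSpace ℝ (Fin d)) : Prop where
  state_eq : ∀ t i, x (t + 1) i =
    ((A ⊗ₖ (1 : Matrix (Fin d) (Fin d) ℝ)) *ᵥ (fun k => x t k)) i +
      ((B ⊗ₖ (1 : Matrix (Fin d) (Fin d) ℝ)) *ᵥ (fun k => w t k.2)) i
  output_eq : ∀ t j, z t j =
    ((C ⊗ₖ (1 : Matrix (Fin d) (Fin d) ℝ)) *ᵥ (fun k => x t k)) (0, j)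
  feedback_eq : ∀ t, w t = gradient f (z t)

/-! ### The filter -/

/-- The companion matrix `C_α` of a monic polynomial `α` of degree `l`: ones on the superdiagonal
and last row `(-α₀, …, -α_{l-1})`. -/
def companion (l : ℕ) (α : Polynomial ℝ) : Matrix (Fin l) (Fin l) ℝ :=
  Matrix.of fun i j =>
    if (i : ℕ) + 1 = l then -α.coeff j else if (j : ℕ) = (i : ℕ) + 1 then 1 else 0

/-- The last standard unit vector `e_l ∈ ℝ^l`, as a column. -/
def lastUnit (l : ℕ) : Matrix (Fin l) (Fin 1) ℝ :=
  Matrix.of fun i _ => if (i : ℕ) + 1 = l then 1 else 0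

/-- Kalman's controllability matrix `(B, A B, …, A^{l-1} B)`; its column `(ν, k)` is the
`k`-th column of `A^ν B`. -/
def controllabilityMatrix {l k : ℕ} (A : Matrix (Fin l) (Fin l) ℝ)
    (B : Matrix (Fin l) (Fin k) ℝ) : Matrix (Fin l) (Fin l × Fin k) ℝ :=
  Matrix.of fun i p => (A ^ (p.1 : ℕ) * B) i p.2

/-- The polynomial `α` is monic of degree `l`, all its complex roots lie in the open disk
`{z | |z| < ρ}`, and `α₀, …, α_{l-1} ≤ 0`. -/
structure IsFilterPolynomial (ρ : ℝ) (l : ℕ) (α : Polynomial ℝ) : Prop where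
  monic : α.Monic
  natDegree_eq : α.natDegree = l
  roots_lt : ∀ s : ℂ, Polynomial.aeval s α = 0 → ‖s‖ < ρ
  coeff_nonpos : ∀ j < l, α.coeff j ≤ 0

/-- The linear constraints on the filter coefficients: `C_f K(A_f, B_f) ≤ 0` entrywise and
`D_f + C_f (ρ I - A_f)⁻¹ B_f > 0`. -/
def FilterConstraints (ρ : ℝ) {l : ℕ} (Af : Matrix (Fin l) (Fin l) ℝ)
    (Bf : Matrix (Fin l) (Fin 1) ℝ) (Cf : Matrix (Fin 1) (Fin l) ℝ) (Df : ℝ) : Prop :=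
  (∀ i p, (Cf * controllabilityMatrix Af Bf) i p ≤ 0) ∧
    0 < Df + (Cf * (ρ • (1 : Matrix (Fin l) (Fin l) ℝ) - Af)⁻¹ * Bf) 0 0

/-! ### The filtered series realization -/

/-- The matrix `[A_f, B_f (L-m) C; 0, ρ⁻¹ (A + B m C)]`. -/
def seriesA (ρ m L : ℝ) {l n : ℕ} (Af : Matrix (Fin l) (Fin l) ℝ) (Bf : Matrix (Fin l) (Fin 1) ℝ)
    (A : Matrix (Fin n) (Fin n) ℝ) (B : Matrix (Fin n) (Fin 1) ℝ) (C : Matrix (Fin 1) (Fin n) ℝ) :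
    Matrix (Fin l ⊕ Fin n) (Fin l ⊕ Fin n) ℝ :=
  fromBlocks Af (Bf * ((L - m) • C)) 0 (ρ⁻¹ • (A + B * (m • C)))

/-- The matrix `[-B_f; ρ⁻¹ B]`. -/
def seriesB (ρ : ℝ) {l n : ℕ} (Bf : Matrix (Fin l) (Fin 1) ℝ) (B : Matrix (Fin n) (Fin 1) ℝ) :
    Matrix (Fin l ⊕ Fin n) (Fin 1) ℝ :=
  fromRows (-Bf) (ρ⁻¹ • B)

/-- The matrix `[C_f, D_f (L-m) C]`. -/
def seriesC (m L : ℝ) {l n : ℕ} (Cf : Matrix (Fin 1) (Fin l) ℝ) (Df : ℝ)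
    (C : Matrix (Fin 1) (Fin n) ℝ) : Matrix (Fin 1) (Fin l ⊕ Fin n) ℝ :=
  fromCols Cf (Df • ((L - m) • C))

/-- The `1 × 1` matrix `-D_f`. -/
def seriesD (Df : ℝ) : Matrix (Fin 1) (Fin 1) ℝ := -(Df • (1 : Matrix (Fin 1) (Fin 1) ℝ))

/-! ### The linear matrix inequality -/

/-- The matrix inequality `X = Xᵀ ≻ 0` and
`[𝒜 ℬ; I 0]ᵀ [X 0; 0 -X] [𝒜 ℬ; I 0] + [𝒞 𝒟; 0 1]ᵀ [0 1; 1 0] [𝒞 𝒟; 0 1] ≺ 0`.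
`Matrix.PosDef` includes the symmetry of the matrix. -/
def PassivityLMI {ι : Type*} [Fintype ι] [DecidableEq ι] (𝒜 : Matrix ι ι ℝ)
    (ℬ : Matrix ι (Fin 1) ℝ) (𝒞 : Matrix (Fin 1) ι ℝ) (𝒟 : Matrix (Fin 1) (Fin 1) ℝ)
    (X : Matrix ι ι ℝ) : Prop :=
  X.PosDef ∧
    (-((fromBlocks 𝒜 ℬ (1 : Matrix ι ι ℝ) (0 : Matrix ι (Fin 1) ℝ))ᵀ * fromBlocks X 0 0 (-X) *
          fromBlocks 𝒜 ℬ (1 : Matrix ι ι ℝ) (0 : Matrix ι (Fin 1) ℝ) +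
        (fromBlocks 𝒞 𝒟 (0 : Matrix (Fin 1) ι ℝ) (1 : Matrix (Fin 1) (Fin 1) ℝ))ᵀ *
            fromBlocks (0 : Matrix (Fin 1) (Fin 1) ℝ) 1 1 (0 : Matrix (Fin 1) (Fin 1) ℝ) *
          fromBlocks 𝒞 𝒟 (0 : Matrix (Fin 1) ι ℝ) (1 : Matrix (Fin 1) (Fin 1) ℝ))).PosDef

end RobustOpt

end

/-! With signals weighted by `ρ⁻ᵗ`, the matrix inequality is a strict dissipation inequality for the
series connection of plant and filter, with storage given by `X`. Summed over time and over the `d`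
coordinates, it bounds the weighted state by `‖x 0‖²`, provided the total supply is nonnegative
(`exists_summed_dissipation`). That supply is a Zames–Falb sum of `⟪u_t, y_s⟫`, with `u = ∇f(z) - m
z` and `y = (L - m) z - u`. For `g = f - m q`, the function `V = (L - m) g - ‖∇g‖² / 2` is
nonnegative and satisfies `⟪u_t, y_s⟫ ≤ ⟪u_t, y_t⟫ - V_t + V_s` (`storage_sub_le`). The sum is then
nonnegative if the impulse response `h` of the filter has `h_k ≤ 0` for `k ≥ 1` and nonnegative
partial sums of `h_k ρ⁻ᵏ` (`zamesFalb_sum_nonneg`). Both follow from the finitely many filter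
constraints: nonnegativity of `-α_j` propagates the signs by Cayley–Hamilton, so the partial sums
decrease, and their limit is positive. -/

namespace RobustOpt

/-! ### Subgradients and interpolation for smooth convex functions -/

section Convex

variable {E : Type*} [NormedAddCommGroup E] [InnerProductSpace ℝ E]

/-- The interpolation inequality of smooth convex functions. -/
theorem interpolation_le {M : ℝ} (hM : 0 < M) {g : E → ℝ} {a b p r : E}
    (hp : ∀ y, g a + inner ℝ p (y - a) ≤ g y)
    (hr : ∀ y, g y ≤ g b + inner ℝ r (y - b) + M / 2 * ‖y - b‖ ^ 2) :
    g a + inner ℝ p (b - a) + 1 / (2 * M) * ‖r - p‖ ^ 2 ≤ g b := by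
  -- This point minimises the quadratic upper bound at `b` minus the affine lower bound at `a`.
  have h1 := hp (b - M⁻¹ • (r - p))
  have h2 := hr (b - M⁻¹ • (r - p))
  have e1 : b - M⁻¹ • (r - p) - a = (b - a) - M⁻¹ • (r - p) := by abel
  have e2 : b - M⁻¹ • (r - p) - b = -(M⁻¹ • (r - p)) := by abel
  rw [e1, inner_sub_right, real_inner_smul_right] at h1
  rw [e2, inner_neg_right, real_inner_smul_right, norm_neg, norm_smul, mul_pow, Real.norm_eq_abs,
    sq_abs] at h2
  have h3 : ‖r - p‖ ^ 2 = inner ℝ r (r - p) - inner ℝ p (r - p) := by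
    rw [← inner_sub_left, real_inner_self_eq_norm_sq]
  have h4 : M / 2 * (M⁻¹ ^ 2 * ‖r - p‖ ^ 2) = M⁻¹ / 2 * ‖r - p‖ ^ 2 := by
    field_simp
  have h5 : 1 / (2 * M) * ‖r - p‖ ^ 2 = M⁻¹ / 2 * ‖r - p‖ ^ 2 := by
    field_simp
  have h6 : M⁻¹ * ‖r - p‖ ^ 2 = M⁻¹ * inner ℝ r (r - p) - M⁻¹ * inner ℝ p (r - p) := by
    rw [h3]; ring
  linarith

/-- The dissipation inequality `⟪p, y_a - y_b⟫ ≥ V_a - V_b` for the supply `y = M z - ∇ g z` and the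
storage `V = M g - ‖∇ g‖² / 2`. -/
theorem storage_sub_le {M : ℝ} (hM : 0 < M) {g : E → ℝ} {a b p r : E}
    (hp : ∀ y, g a + inner ℝ p (y - a) ≤ g y)
    (hr : ∀ y, g y ≤ g b + inner ℝ r (y - b) + M / 2 * ‖y - b‖ ^ 2) :
    inner ℝ p (M • b - r) ≤ inner ℝ p (M • a - p) - (M * g a - 1 / 2 * ‖p‖ ^ 2) +
      (M * g b - 1 / 2 * ‖r‖ ^ 2) := by
  have h := mul_le_mul_of_nonneg_left (interpolation_le hM hp hr) hM.le
  have h1 : M * (1 / (2 * M) * ‖r - p‖ ^ 2) = 1 / 2 * ‖r - p‖ ^ 2 := by field_simp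
  rw [mul_add, h1, norm_sub_sq_real, real_inner_comm p r, inner_sub_right] at h
  simp only [inner_sub_right, real_inner_smul_right, real_inner_self_eq_norm_sq]
  linarith

variable [FiniteDimensional ℝ E]

/-- A finite convex function on a finite-dimensional space has a subgradient at every point. -/
theorem exists_subgradient {g : E → ℝ} (hg : ConvexOn ℝ Set.univ g) (x : E) :
    ∃ p : E, ∀ y, g x + inner ℝ p (y - x) ≤ g y := by
  have hcont : Continuous g := continuousOn_univ.1 (hg.continuousOn isOpen_univ)
  have hopen : IsOpen {p : E × ℝ | p.1 ∈ Set.univ ∧ g p.1 < p.2} := by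
    simpa using isOpen_lt (hcont.comp continuous_fst) continuous_snd
  obtain ⟨φ, hφ⟩ := geometric_hahn_banach_open_point (x := (x, g x))
    hg.convex_strict_epigraph hopen (by simp)
  have key : ∀ y s, φ (y, s) = φ (y, 0) + s * φ (0, 1) := by
    intro y s
    have : ((y, s) : E × ℝ) = (y, 0) + s • (0, 1) := by simp
    rw [this, map_add, map_smul, smul_eq_mul]
  -- The separating hyperplane is not vertical, so `φ` can be normalised to give a slope.
  have hc : φ (0, 1) < 0 := by
    have := hφ (x, g x + 1) (by simp)
    rw [key x, key x (g x)] at this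
    linarith
  have hle : ∀ y, φ (y, 0) + g y * φ (0, 1) ≤ φ (x, 0) + g x * φ (0, 1) := by
    intro y
    refine le_of_forall_pos_le_add fun ε hε => ?_
    have hδ : 0 < ε / -φ (0, 1) := div_pos hε (by linarith)
    have := hφ (y, g y + ε / -φ (0, 1)) (by simpa using hδ)
    rw [key y, key x (g x), add_mul] at this
    have h2 : ε / -φ (0, 1) * φ (0, 1) = -ε := by
      have := hc.ne
      field_simp
    linarith
  refine ⟨(InnerProductSpace.toDual ℝ E).symm
    ((-φ (0, 1))⁻¹ • φ.comp (ContinuousLinearMap.inl ℝ E ℝ)), fun y => ?_⟩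
  rw [InnerProductSpace.toDual_symm_apply]
  have h1 : φ (y - x, 0) = φ (y, 0) - φ (x, 0) := by
    rw [← map_sub]; simp
  have h2 : φ (y - x, 0) ≤ (-φ (0, 1)) * (g y - g x) := by
    have := hle y
    rw [h1]; linarith
  have h3 : (-φ (0, 1))⁻¹ * φ (y - x, 0) ≤ g y - g x := by
    rw [inv_mul_le_iff₀ (by linarith)]; exact h2
  simp only [_root_.smul_apply, ContinuousLinearMap.comp_apply,
    ContinuousLinearMap.inl_apply, smul_eq_mul]
  linarith

/-- A convex function `g` with `M ‖·‖² / 2 - g` convex lies between its tangent at a point and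
that tangent plus `M ‖· - x‖² / 2`. -/
theorem exists_tangent_sandwich {M : ℝ} {g : E → ℝ} (hg : ConvexOn ℝ Set.univ g)
    (hk : ConvexOn ℝ Set.univ fun y => M * (1 / 2 * ‖y‖ ^ 2) - g y) (x : E) :
    ∃ p : E, ∀ y, g x + inner ℝ p (y - x) ≤ g y ∧
      g y ≤ g x + inner ℝ p (y - x) + M / 2 * ‖y - x‖ ^ 2 := by
  obtain ⟨p, hp⟩ := exists_subgradient hg x
  obtain ⟨r, hr⟩ := exists_subgradient hk x
  have hexp : ∀ y, ‖y‖ ^ 2 = ‖x‖ ^ 2 + 2 * inner ℝ x (y - x) + ‖y - x‖ ^ 2 := by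
    intro y
    rw [← norm_add_sq_real]; simp
  -- Adding the two subgradient inequalities cancels `g`. A linear form with a quadratic upper bound
  -- vanishes, so `p + r = M x`.
  have hsum : ∀ y, inner ℝ (p + r - M • x) (y - x) ≤ M / 2 * ‖y - x‖ ^ 2 := by
    intro y
    have h1 := hp y
    have h2 := hr y
    have h3 := hexp y
    simp only [inner_sub_left, inner_add_left, real_inner_smul_left]
    rw [h3] at h2
    linarith
  have hzero : p + r - M • x = 0 := by
    set v := p + r - M • x with hv
    by_contra hne
    have hpos : 0 < ‖v‖ ^ 2 := by positivity
    have hT : ∀ t : ℝ, t * ‖v‖ ^ 2 ≤ M / 2 * (t ^ 2 * ‖v‖ ^ 2) := by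
      intro t
      have := hsum (x + t • v)
      rw [add_sub_cancel_left, real_inner_smul_right, real_inner_self_eq_norm_sq, norm_smul,
        mul_pow, Real.norm_eq_abs, sq_abs] at this
      exact this
    have hT' : ∀ t : ℝ, t ≤ M / 2 * t ^ 2 := by
      intro t
      have := hT t
      rw [← mul_assoc] at this
      exact le_of_mul_le_mul_right this hpos
    -- A step so small that `M t / 2 < 1`, whatever the sign of `M`.
    have hA := hT' (1 / (|M| + 1))
    have hB : 0 < 1 / (|M| + 1) := by positivity
    have hC : M / 2 * (1 / (|M| + 1)) < 1 := by
      rw [mul_one_div, div_lt_one (by positivity)]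
      linarith [le_abs_self M, abs_nonneg M]
    nlinarith
  refine ⟨p, fun y => ⟨hp y, ?_⟩⟩
  have h2 := hr y
  have hr' : r = M • x - p := by
    rw [← sub_eq_zero, ← hzero]; abel
  rw [hexp y, hr', inner_sub_left, real_inner_smul_left] at h2
  linarith

end Convex

/-- The tangent bounds of the convex, `(L - m)`-smooth function `f - m q`, whose gradient is
`∇ f - m id`. -/
theorem MemS.sandwich {m L : ℝ} {d : ℕ} {f : EuclideanSpace ℝ (Fin d) → ℝ} (hf : MemS m L f)
    (x y : EuclideanSpace ℝ (Fin d)) :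
    (f x - m * halfSq x) + inner ℝ (gradient f x - m • x) (y - x) ≤ f y - m * halfSq y ∧
      f y - m * halfSq y ≤ (f x - m * halfSq x) + inner ℝ (gradient f x - m • x) (y - x) +
        (L - m) / 2 * ‖y - x‖ ^ 2 := by
  obtain ⟨p, hp⟩ := exists_tangent_sandwich (M := L - m) hf.1
    (by
      have : (fun y => (L - m) * (1 / 2 * ‖y‖ ^ 2) - (f y - m * halfSq y)) =
          fun y => L * halfSq y - f y := by
        funext y
        simp only [halfSq]; ring
      rw [this]
      exact hf.2) x
  -- Differentiability comes from the sandwich, whose error is quadratic; only then is `gradient f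
  -- x` more than a default value.
  have hgrad : HasGradientAt f (p + m • x) x := by
    rw [hasGradientAt_iff_isLittleO]
    refine Asymptotics.IsBigO.trans_isLittleO (g := fun y => ‖y - x‖ ^ 2) ?_ ?_
    · refine Asymptotics.IsBigO.of_bound (|L| + |m|) (Filter.Eventually.of_forall fun y => ?_)
      obtain ⟨h1, h2⟩ := hp y
      have hexp : ‖y‖ ^ 2 = ‖x‖ ^ 2 + 2 * inner ℝ x (y - x) + ‖y - x‖ ^ 2 := by
        rw [← norm_add_sq_real]; simp
      simp only [halfSq] at h1 h2
      rw [hexp] at h1 h2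
      rw [inner_add_left, real_inner_smul_left, Real.norm_eq_abs, Real.norm_eq_abs,
        abs_of_nonneg (sq_nonneg ‖y - x‖), abs_le]
      have hs := sq_nonneg ‖y - x‖
      constructor
      · nlinarith [mul_le_mul_of_nonneg_right (neg_abs_le m) hs,
          mul_nonneg (abs_nonneg L) hs, mul_nonneg (abs_nonneg m) hs]
      · nlinarith [mul_le_mul_of_nonneg_right (le_abs_self L) hs,
          mul_nonneg (abs_nonneg L) hs, mul_nonneg (abs_nonneg m) hs]
    · exact Asymptotics.isLittleO_pow_sub_sub x (by norm_num)
  have : gradient f x - m • x = p := by rw [hgrad.gradient]; simp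
  rw [this]
  exact hp y

/-! ### The Zames–Falb sum -/

/-- A Zames–Falb sum with exponential weights is nonnegative: `a t s` stands for `⟪u_t, y_s⟫`, `V`
for a storage function, and `h` for the impulse response of the filter. -/
theorem zamesFalb_sum_nonneg {ρ : ℝ} (hρ0 : 0 < ρ) (hρ1 : ρ ≤ 1) {a : ℕ → ℕ → ℝ} {V h : ℕ → ℝ}
    (hV : ∀ t, 0 ≤ V t) (hdiag : ∀ t, V t ≤ a t t)
    (hoff : ∀ t s, a t s ≤ a t t - V t + V s) (hneg : ∀ k, h (k + 1) ≤ 0)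
    (hsum : ∀ N, 0 ≤ ∑ k ∈ Finset.range (N + 1), h k * (ρ ^ k)⁻¹) (T : ℕ) :
    0 ≤ ∑ t ∈ Finset.range T, ∑ k ∈ Finset.range (t + 1),
      h k * ((ρ ^ t)⁻¹ * (ρ ^ (t - k))⁻¹) * a t (t - k) := by
  have hpow : ∀ t k, k ≤ t → (ρ ^ t)⁻¹ * (ρ ^ (t - k))⁻¹ = ((ρ ^ t)⁻¹) ^ 2 * ρ ^ k := by
    intro t k hk
    have : ρ ^ t = ρ ^ (t - k) * ρ ^ k := by rw [← pow_add, Nat.sub_add_cancel hk]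
    rw [this]
    field_simp
  -- Since `ρ ≤ 1`, replacing `ρ⁻ᵏ` by `ρᵏ` only weakens the nonpositive terms.
  have hsum' : ∀ N, 0 ≤ ∑ k ∈ Finset.range (N + 1), h k * ρ ^ k := by
    intro N
    refine (hsum N).trans (Finset.sum_le_sum fun k _ => ?_)
    rcases k with _ | k
    · simp
    · refine mul_le_mul_of_nonpos_left ?_ (hneg k)
      calc ρ ^ (k + 1) ≤ 1 := pow_le_one₀ hρ0.le hρ1
        _ ≤ (ρ ^ (k + 1))⁻¹ := (one_le_inv₀ (by positivity)).2 (pow_le_one₀ hρ0.le hρ1)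
  -- As `h_k ≤ 0` for `k ≥ 1`, `hoff` bounds the sum below by a part in `V_{t-k}` and a part in `a t
  -- t - V t`. The former, regrouped by `s = t - k`, carries the partial sums with weights `ρ⁻ᵏ`;
  -- the latter carries those with `ρᵏ`.
  have hlow : 0 ≤ ∑ t ∈ Finset.range T, ∑ k ∈ Finset.range (t + 1),
      h k * ((ρ ^ (k + (t - k)))⁻¹ * (ρ ^ (t - k))⁻¹) * V (t - k) := by
    rw [Finset.sum_range_diag_flip T
      (fun k s => h k * ((ρ ^ (k + s))⁻¹ * (ρ ^ s)⁻¹) * V s), Finset.sum_comm' (t' := Finset.range T)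
      (s' := fun s => Finset.range (T - s)) (by intro x y; simp only [Finset.mem_range]; omega)]
    refine Finset.sum_nonneg fun s hs => ?_
    have hs : s < T := Finset.mem_range.1 hs
    obtain ⟨N, hN⟩ : ∃ N, T - s = N + 1 := ⟨T - s - 1, by omega⟩
    rw [hN]
    have : ∑ k ∈ Finset.range (N + 1), h k * ((ρ ^ (k + s))⁻¹ * (ρ ^ s)⁻¹) * V s =
        (∑ k ∈ Finset.range (N + 1), h k * (ρ ^ k)⁻¹) * (((ρ ^ s)⁻¹) ^ 2 * V s) := by
      rw [Finset.sum_mul]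
      refine Finset.sum_congr rfl fun k _ => ?_
      rw [pow_add, mul_inv]; ring
    rw [this]
    exact mul_nonneg (hsum N) (mul_nonneg (by positivity) (hV s))
  refine hlow.trans (Finset.sum_le_sum fun t _ => ?_)
  have hd : 0 ≤ ((ρ ^ t)⁻¹) ^ 2 * (a t t - V t) * ∑ k ∈ Finset.range (t + 1), h k * ρ ^ k :=
    mul_nonneg (mul_nonneg (by positivity) (sub_nonneg.2 (hdiag t))) (hsum' t)
  rw [Finset.mul_sum] at hd
  rw [← sub_nonneg, ← Finset.sum_sub_distrib]
  refine hd.trans (Finset.sum_le_sum fun k hk => ?_)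
  have hk : k ≤ t := Nat.lt_succ_iff.1 (Finset.mem_range.1 hk)
  rw [Nat.add_sub_cancel' hk, hpow t k hk]
  have hw : 0 ≤ ((ρ ^ t)⁻¹) ^ 2 * ρ ^ k := by positivity
  rcases k with _ | k
  · simp only [Nat.sub_zero, pow_zero]
    exact le_of_eq (by ring)
  · have := mul_le_mul_of_nonpos_left (hoff t (t - (k + 1)))
      (mul_nonpos_of_nonpos_of_nonneg (hneg k) hw)
    linarith

/-! ### The filter -/

variable {ρ : ℝ} {l : ℕ} {α : Polynomial ℝ}

/-- Otherwise the monic `α`, tending to `+∞`, would have a real root in `[ρ, ∞)`. -/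
theorem IsFilterPolynomial.eval_pos (hα : IsFilterPolynomial ρ l α) : 0 < α.eval ρ := by
  by_contra hle
  push Not at hle
  have hdeg : 0 < α.degree := by
    by_contra h0
    have : α = 1 := hα.monic.degree_le_zero_iff_eq_one.1 (not_lt.1 h0)
    rw [this] at hle
    norm_num at hle
  have ht := α.tendsto_atTop_of_leadingCoeff_nonneg hdeg (by rw [hα.monic.leadingCoeff]; simp)
  obtain ⟨b, hb0, hbρ⟩ := ((ht.eventually_ge_atTop 0).and (Filter.eventually_ge_atTop ρ)).exists
  obtain ⟨s, hs, hs0⟩ := intermediate_value_Icc hbρ α.continuous.continuousOn ⟨hle, hb0⟩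
  have h1 : Polynomial.aeval (s : ℂ) α = 0 := by
    have := Polynomial.aeval_algebraMap_apply ℂ s α
    simp only at hs0
    rw [Polynomial.coe_aeval_eq_eval, hs0, map_zero] at this
    exact this
  have h2 := hα.roots_lt _ h1
  rw [Complex.norm_real, Real.norm_eq_abs] at h2
  linarith [le_abs_self s, hs.1]

/-- Such an `r` serves as a decay rate of the filter strictly better than `ρ`. -/
theorem IsFilterPolynomial.exists_eval_nonneg (hα : IsFilterPolynomial ρ l α) (hρ : 0 < ρ) :
    ∃ r, 0 < r ∧ r < ρ ∧ 0 ≤ α.eval r := by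
  have h1 : ∀ᶠ r in 𝓝[<] ρ, 0 < α.eval r :=
    (α.continuous.tendsto ρ).mono_left nhdsWithin_le_nhds |>.eventually_const_lt hα.eval_pos
  obtain ⟨r, hr, hr'⟩ := (h1.and (Ioo_mem_nhdsLT hρ)).exists
  exact ⟨r, hr'.1, hr'.2, hr.le⟩

theorem companion_nonneg (hα : IsFilterPolynomial ρ l α) (i j : Fin l) : 0 ≤ companion l α i j := by
  simp only [companion, of_apply]
  split_ifs
  · have := hα.coeff_nonpos j j.2
    linarith
  · exact zero_le_one
  · exact le_rfl

theorem companion_pow_nonneg (hα : IsFilterPolynomial ρ l α) (N : ℕ) (i j : Fin l) :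
    0 ≤ (companion l α ^ N) i j := by
  induction N generalizing i j with
  | zero =>
    rw [pow_zero, one_apply]
    split_ifs <;> norm_num
  | succ N ih =>
    rw [pow_succ, mul_apply]
    exact Finset.sum_nonneg fun k _ => mul_nonneg (ih i k) (companion_nonneg hα k j)

theorem IsFilterPolynomial.eval_eq (hα : IsFilterPolynomial ρ l α) (r : ℝ) :
    α.eval r = ∑ j : Fin l, α.coeff j * r ^ (j : ℕ) + r ^ l := by
  rw [Polynomial.eval_eq_sum_range, hα.natDegree_eq, Finset.sum_range_succ, Finset.sum_range]
  congr 1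
  have : α.coeff l = 1 := by rw [← hα.natDegree_eq]; exact hα.monic.coeff_natDegree
  rw [this, one_mul]

/-- A Perron-type test vector: every row but the last gives equality, and the defect in the last row
is `α(r)`. -/
theorem companion_mulVec_pow_le (hα : IsFilterPolynomial ρ l α) {r : ℝ} (hr : 0 ≤ α.eval r)
    (i : Fin l) : (companion l α *ᵥ fun j => r ^ (j : ℕ)) i ≤ r * r ^ (i : ℕ) := by
  by_cases hi : (i : ℕ) + 1 = l
  · rw [hα.eval_eq] at hr
    have : (companion l α *ᵥ fun j => r ^ (j : ℕ)) i = -∑ j : Fin l, α.coeff j * r ^ (j : ℕ) := by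
      simp [mulVec, dotProduct, companion, hi]
    rw [this, ← pow_succ', hi]
    linarith
  · have hi' : (i : ℕ) + 1 < l := by omega
    apply le_of_eq
    simp only [mulVec, dotProduct, companion, of_apply, if_neg hi]
    rw [Finset.sum_eq_single ⟨i + 1, hi'⟩]
    · simp [pow_succ']
    · intro b _ hb
      rw [if_neg, zero_mul]
      exact fun h => hb (Fin.ext h)
    · simp

/-- Entrywise nonnegativity lets the test-vector inequality be iterated; for `r > 0` this makes
every entry of the powers `O(r ^ N)`. -/
theorem companion_pow_sum_le (hα : IsFilterPolynomial ρ l α) {r : ℝ} (hr0 : 0 ≤ r)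
    (hr : 0 ≤ α.eval r) (N : ℕ) (i : Fin l) :
    ∑ j, (companion l α ^ N) i j * r ^ (j : ℕ) ≤ r ^ N * r ^ (i : ℕ) := by
  induction N with
  | zero => simp [one_apply]
  | succ N ih =>
    have : ∑ j, (companion l α ^ (N + 1)) i j * r ^ (j : ℕ) =
        ∑ k, (companion l α ^ N) i k * (companion l α *ᵥ fun j => r ^ (j : ℕ)) k := by
      change ((companion l α ^ (N + 1)) *ᵥ fun j : Fin l => r ^ (j : ℕ)) i =
        ((companion l α ^ N) *ᵥ (companion l α *ᵥ fun j : Fin l => r ^ (j : ℕ))) i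
      rw [mulVec_mulVec, pow_succ]
    rw [this]
    calc _ ≤ ∑ k, (companion l α ^ N) i k * (r * r ^ (k : ℕ)) :=
          Finset.sum_le_sum fun k _ => mul_le_mul_of_nonneg_left
            (companion_mulVec_pow_le hα hr k) (companion_pow_nonneg hα N i k)
      _ = r * ∑ k, (companion l α ^ N) i k * r ^ (k : ℕ) := by
          rw [Finset.mul_sum]
          exact Finset.sum_congr rfl fun k _ => by ring
      _ ≤ r * (r ^ N * r ^ (i : ℕ)) := mul_le_mul_of_nonneg_left ih hr0
      _ = r ^ (N + 1) * r ^ (i : ℕ) := by ring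

/-- The filter is exponentially stable with rate `ρ`. -/
theorem tendsto_companion_pow (hα : IsFilterPolynomial ρ l α) (hρ : 0 < ρ) :
    Filter.Tendsto (fun N => (ρ⁻¹ • companion l α) ^ N) Filter.atTop (𝓝 0) := by
  obtain ⟨r, hr0, hrρ, hr⟩ := hα.exists_eval_nonneg hρ
  refine tendsto_pi_nhds.2 fun i => tendsto_pi_nhds.2 fun j => ?_
  have hlim : Filter.Tendsto (fun N : ℕ => (r / ρ) ^ N * (r ^ (i : ℕ) / r ^ (j : ℕ)))
      Filter.atTop (𝓝 0) := by
    simpa using (tendsto_pow_atTop_nhds_zero_of_lt_one (by positivity)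
      ((div_lt_one hρ).2 hrρ)).mul_const (r ^ (i : ℕ) / r ^ (j : ℕ))
  refine squeeze_zero (fun N => ?_) (fun N => ?_) hlim
  · rw [smul_pow, Matrix.smul_apply, smul_eq_mul]
    exact mul_nonneg (by positivity) (companion_pow_nonneg hα N i j)
  · rw [smul_pow, Matrix.smul_apply, smul_eq_mul]
    have h1 : (companion l α ^ N) i j * r ^ (j : ℕ) ≤ r ^ N * r ^ (i : ℕ) :=
      (Finset.single_le_sum (f := fun j : Fin l => (companion l α ^ N) i j * r ^ (j : ℕ))
        (fun k _ => mul_nonneg (companion_pow_nonneg hα N i k) (by positivity))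
        (Finset.mem_univ j)).trans (companion_pow_sum_le hα hr0.le hr N i)
    rw [← le_div_iff₀ (by positivity)] at h1
    calc _ ≤ ρ⁻¹ ^ N * (r ^ N * r ^ (i : ℕ) / r ^ (j : ℕ)) :=
          mul_le_mul_of_nonneg_left h1 (by positivity)
      _ = _ := by rw [div_pow, inv_pow]; field_simp

/-- A kernel vector would be fixed by all powers of `ρ⁻¹ • companion l α`, which tend to `0`. -/
theorem isUnit_sub_companion (hα : IsFilterPolynomial ρ l α) (hρ : 0 < ρ) :
    IsUnit (ρ • (1 : Matrix (Fin l) (Fin l) ℝ) - companion l α).det := by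
  rw [isUnit_iff_ne_zero]
  intro h0
  obtain ⟨v, hv, hv0⟩ := exists_mulVec_eq_zero_iff.2 h0
  rw [sub_mulVec, smul_mulVec, one_mulVec, sub_eq_zero] at hv0
  have h1 : (ρ⁻¹ • companion l α) *ᵥ v = v := by
    rw [smul_mulVec, ← hv0, smul_smul, inv_mul_cancel₀ hρ.ne', one_smul]
  have h2 : ∀ N, ((ρ⁻¹ • companion l α) ^ N) *ᵥ v = v := by
    intro N
    induction N with
    | zero => simp
    | succ N ih => rw [pow_succ, ← mulVec_mulVec, h1, ih]
  have hc : Continuous fun P : Matrix (Fin l) (Fin l) ℝ => P *ᵥ v :=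
    continuous_id.matrix_mulVec continuous_const
  have h3 := (hc.tendsto 0).comp (tendsto_companion_pow hα hρ)
  simp only [Function.comp_def, h2, zero_mulVec] at h3
  exact hv (tendsto_nhds_unique tendsto_const_nhds h3)

/-- The impulse response of the filter `(A, B, C, D)`. -/
def impulse (A : Matrix (Fin l) (Fin l) ℝ) (B : Matrix (Fin l) (Fin 1) ℝ)
    (C : Matrix (Fin 1) (Fin l) ℝ) (D : ℝ) : ℕ → ℝ
  | 0 => D
  | k + 1 => (C * (A ^ k * B)) 0 0

/-- Neumann series of the resolvent: the limit is the transfer function of the filter at `ρ`. -/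
theorem tendsto_sum_impulse (hα : IsFilterPolynomial ρ l α) (hρ : 0 < ρ)
    (B : Matrix (Fin l) (Fin 1) ℝ) (C : Matrix (Fin 1) (Fin l) ℝ) (D : ℝ) :
    Filter.Tendsto
      (fun N => ∑ k ∈ Finset.range (N + 1), impulse (companion l α) B C D k * (ρ ^ k)⁻¹)
      Filter.atTop
      (𝓝 (D + (C * (ρ • (1 : Matrix (Fin l) (Fin l) ℝ) - companion l α)⁻¹ * B) 0 0)) := by
  set A := companion l α with hA
  set R := ρ • (1 : Matrix (Fin l) (Fin l) ℝ) - A with hR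
  have hRu : IsUnit R.det := isUnit_sub_companion hα hρ
  have hgeom : ∀ N, ∑ k ∈ Finset.range N, (ρ ^ (k + 1))⁻¹ • A ^ k = R⁻¹ * (1 - (ρ⁻¹ • A) ^ N) := by
    intro N
    have h1 : R * ∑ k ∈ Finset.range N, (ρ ^ (k + 1))⁻¹ • A ^ k = 1 - (ρ⁻¹ • A) ^ N := by
      induction N with
      | zero => simp
      | succ N ih =>
        rw [Finset.sum_range_succ, mul_add, ih, hR, sub_mul, smul_mul_assoc, one_mul, smul_smul,
          mul_smul_comm, ← pow_succ', smul_pow, smul_pow, inv_pow, inv_pow]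
        have : ρ * (ρ ^ (N + 1))⁻¹ = (ρ ^ N)⁻¹ := by
          rw [pow_succ]; field_simp
        rw [this]; abel
    rw [← h1, nonsing_inv_mul_cancel_left _ _ hRu]
  have hterm : ∀ N, ∑ k ∈ Finset.range (N + 1), impulse A B C D k * (ρ ^ k)⁻¹ =
      (C * (R⁻¹ * (1 - (ρ⁻¹ • A) ^ N)) * B : Matrix (Fin 1) (Fin 1) ℝ) 0 0 + D := by
    intro N
    rw [Finset.sum_range_succ', ← hgeom, Matrix.mul_sum, Matrix.sum_mul, Matrix.sum_apply]
    simp only [impulse, pow_zero, inv_one, mul_one]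
    congr 1
    refine Finset.sum_congr rfl fun k _ => ?_
    rw [Matrix.mul_smul, Matrix.smul_mul, Matrix.smul_apply, smul_eq_mul, mul_comm, Matrix.mul_assoc]
  simp only [hterm]
  have hc : Continuous fun P : Matrix (Fin l) (Fin l) ℝ => (C * (R⁻¹ * (1 - P)) * B : Matrix (Fin 1) (Fin 1) ℝ) 0 0 + D := by
    refine Continuous.add (Continuous.matrix_elem ?_ 0 0) continuous_const
    fun_prop
  have h3 := (hc.tendsto 0).comp (tendsto_companion_pow hα hρ)
  simpa [Function.comp_def, add_comm D] using h3

/-- The first rows of the powers of a companion matrix are unit vectors. -/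
theorem single_vecMul_companion_pow (hl : 0 < l) (k : ℕ) (hk : k < l) :
    Pi.single (⟨0, hl⟩ : Fin l) (1 : ℝ) ᵥ* companion l α ^ k = Pi.single ⟨k, hk⟩ 1 := by
  induction k with
  | zero => simp
  | succ k ih =>
    rw [pow_succ, ← vecMul_vecMul, ih (by omega)]
    ext j
    simp only [single_vecMul, one_smul, row_apply, companion, of_apply, Pi.single_apply, Fin.ext_iff]
    rw [if_neg (by omega)]

/-- A companion matrix is annihilated by its polynomial. -/
theorem companion_pow_eq (α : Polynomial ℝ) (l : ℕ) :
    companion l α ^ l = ∑ j : Fin l, (-α.coeff j) • companion l α ^ (j : ℕ) := by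
  rcases Nat.eq_zero_or_pos l with rfl | hl
  · exact Subsingleton.elim _ _
  set A := companion l α with hA
  have h0 : Pi.single (⟨0, hl⟩ : Fin l) (1 : ℝ) ᵥ* A ^ l =
      Pi.single (⟨0, hl⟩ : Fin l) (1 : ℝ) ᵥ* ∑ j : Fin l, (-α.coeff j) • A ^ (j : ℕ) := by
    obtain ⟨p, rfl⟩ : ∃ p, l = p + 1 := ⟨l - 1, by omega⟩
    rw [vecMul_sum, pow_succ, ← vecMul_vecMul, hA, single_vecMul_companion_pow hl p (by omega)]
    simp only [vecMul_smul]
    rw [Finset.sum_congr rfl fun j _ => by rw [single_vecMul_companion_pow hl j j.2]]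
    ext i
    simp [companion, Pi.single_apply, Finset.sum_apply]
  ext i j
  -- Since `e₀ Aⁱ = eᵢ`, a matrix commuting with `A` is determined by its first row, so comparing
  -- first rows suffices.
  have h1 : ∀ P : Matrix (Fin l) (Fin l) ℝ, Commute A P →
      P i = (Pi.single (⟨0, hl⟩ : Fin l) (1 : ℝ) ᵥ* P) ᵥ* A ^ (i : ℕ) := by
    intro P hP
    rw [vecMul_vecMul, ← (hP.pow_left i).eq, ← vecMul_vecMul, hA,
      single_vecMul_companion_pow hl i i.2]
    simp [row]
  have hc : Commute A (∑ j : Fin l, (-α.coeff j) • A ^ (j : ℕ)) :=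
    Commute.sum_right _ _ _ fun j _ => ((Commute.refl A).pow_right j).smul_right _
  rw [h1 _ ((Commute.refl A).pow_right l), h0, ← h1 _ hc]

/-- The constraint covers the first `l` values; each later one is a combination of the preceding `l`
with weights `-α_j ≥ 0`. -/
theorem impulse_succ_nonpos (hα : IsFilterPolynomial ρ l α) {B : Matrix (Fin l) (Fin 1) ℝ}
    {C : Matrix (Fin 1) (Fin l) ℝ} {D : ℝ}
    (h : ∀ i p, (C * controllabilityMatrix (companion l α) B) i p ≤ 0) (k : ℕ) :
    impulse (companion l α) B C D (k + 1) ≤ 0 := by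
  change (C * (companion l α ^ k * B)) 0 0 ≤ 0
  induction k using Nat.strong_induction_on with
  | _ k ih =>
    by_cases hk : k < l
    · exact h 0 (⟨k, hk⟩, 0)
    · obtain ⟨p, rfl⟩ : ∃ p, k = p + l := ⟨k - l, by omega⟩
      rw [pow_add, companion_pow_eq, Matrix.mul_sum, Matrix.sum_mul, Matrix.mul_sum,
        Matrix.sum_apply]
      refine Finset.sum_nonpos fun j _ => ?_
      rw [Matrix.mul_smul, Matrix.smul_mul, Matrix.mul_smul, Matrix.smul_apply, smul_eq_mul, ← pow_add]
      exact mul_nonpos_of_nonneg_of_nonpos (by have := hα.coeff_nonpos j j.2; linarith)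
        (ih (p + j) (by omega))

theorem sum_impulse_nonneg (hα : IsFilterPolynomial ρ l α) (hρ : 0 < ρ)
    {B : Matrix (Fin l) (Fin 1) ℝ} {C : Matrix (Fin 1) (Fin l) ℝ} {D : ℝ}
    (h : FilterConstraints ρ (companion l α) B C D) (N : ℕ) :
    0 ≤ ∑ k ∈ Finset.range (N + 1), impulse (companion l α) B C D k * (ρ ^ k)⁻¹ := by
  have hanti : Antitone fun N =>
      ∑ k ∈ Finset.range (N + 1), impulse (companion l α) B C D k * (ρ ^ k)⁻¹ := by
    refine antitone_nat_of_succ_le fun N => ?_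
    rw [Finset.sum_range_succ _ (N + 1)]
    have := mul_nonpos_of_nonpos_of_nonneg (impulse_succ_nonpos hα (D := D) h.1 N)
      (by positivity : 0 ≤ (ρ ^ (N + 1))⁻¹)
    linarith
  exact h.2.le.trans (hanti.le_of_tendsto (tendsto_sum_impulse hα hρ B C D) N)

/-! ### Quadratic forms and the matrix inequality -/

/-- Compactness of the unit sphere, then homogeneity. -/
theorem exists_mul_dotProduct_le {ι : Type*} [Fintype ι] {P : Matrix ι ι ℝ} (hP : P.PosDef) :
    ∃ c > 0, ∀ v : ι → ℝ, c * (v ⬝ᵥ v) ≤ v ⬝ᵥ P *ᵥ v := by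
  let φ : EuclideanSpace ℝ ι → ℝ := fun v => v.ofLp ⬝ᵥ P *ᵥ v.ofLp
  have hφ : Continuous φ := by
    have h : Continuous fun v : EuclideanSpace ℝ ι => v.ofLp := by fun_prop
    exact h.dotProduct (continuous_const.matrix_mulVec h)
  obtain ⟨c, hc, hcv⟩ := (isCompact_sphere (0 : EuclideanSpace ℝ ι) 1).exists_forall_le'
    hφ.continuousOn (a := 0) (fun v hv => by
      have hv0 : v.ofLp ≠ 0 := by
        intro h0
        have : v = 0 := by ext i; exact congrFun h0 i
        simp [this] at hv
      simpa using hP.dotProduct_mulVec_pos hv0)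
  refine ⟨c, hc, fun v => ?_⟩
  by_cases hv : v = 0
  · simp [hv]
  set V : EuclideanSpace ℝ ι := WithLp.toLp 2 v with hV
  have hV0 : V ≠ 0 := by simpa [hV] using hv
  have hn : 0 < ‖V‖ := norm_pos_iff.2 hV0
  have hsq : v ⬝ᵥ v = ‖V‖ ^ 2 := by
    rw [EuclideanSpace.real_norm_sq_eq]
    simp [dotProduct, hV, sq]
  have h1 := hcv (‖V‖⁻¹ • V) (by simp [norm_smul, hn.ne'])
  have h2 : φ (‖V‖⁻¹ • V) = (‖V‖ ^ 2)⁻¹ * (v ⬝ᵥ P *ᵥ v) := by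
    simp only [φ, WithLp.ofLp_smul, mulVec_smul, smul_dotProduct, dotProduct_smul, smul_eq_mul, hV]
    ring
  rw [h2, ← div_eq_inv_mul, le_div_iff₀ (by positivity)] at h1
  rwa [hsq]

theorem exists_dotProduct_mulVec_le {ι : Type*} [Fintype ι] (P : Matrix ι ι ℝ) :
    ∃ c, ∀ v : ι → ℝ, v ⬝ᵥ P *ᵥ v ≤ c * (v ⬝ᵥ v) := by
  refine ⟨∑ i, ∑ j, |P i j|, fun v => ?_⟩
  have hsq : ∀ i, v i ^ 2 ≤ v ⬝ᵥ v := by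
    intro i
    rw [sq]
    exact Finset.single_le_sum (f := fun i => v i * v i) (fun i _ => mul_self_nonneg (v i))
      (Finset.mem_univ i)
  change ∑ i, v i * ∑ j, P i j * v j ≤ _
  simp only [Finset.mul_sum, Finset.sum_mul]
  refine Finset.sum_le_sum fun i _ => Finset.sum_le_sum fun j _ => ?_
  have h1 : |v i * v j| ≤ v ⬝ᵥ v := by
    rw [abs_le]
    constructor <;> nlinarith [hsq i, hsq j, sq_nonneg (v i + v j), sq_nonneg (v i - v j)]
  calc v i * (P i j * v j) ≤ |v i * (P i j * v j)| := le_abs_self _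
    _ = |P i j| * |v i * v j| := by rw [← abs_mul]; congr 1; ring
    _ ≤ |P i j| * (v ⬝ᵥ v) := mul_le_mul_of_nonneg_left h1 (abs_nonneg _)

theorem dotProduct_fin_one (v w : Fin 1 → ℝ) : v ⬝ᵥ w = v 0 * w 0 := by
  simp [dotProduct]

theorem dotProduct_congruence_mulVec {ι κ : Type*} [Fintype ι] [Fintype κ] (F : Matrix κ ι ℝ)
    (G : Matrix κ κ ℝ) (q : ι → ℝ) :
    q ⬝ᵥ (Fᵀ * G * F) *ᵥ q = (F *ᵥ q) ⬝ᵥ G *ᵥ (F *ᵥ q) := by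
  rw [← mulVec_mulVec, ← mulVec_mulVec, dotProduct_mulVec, vecMul_transpose]

/-- The strict dissipation inequality encoded by the matrix inequality. -/
theorem PassivityLMI.exists_dissipation {ι : Type*} [Fintype ι] [DecidableEq ι]
    {𝒜 : Matrix ι ι ℝ} {ℬ : Matrix ι (Fin 1) ℝ} {𝒞 : Matrix (Fin 1) ι ℝ}
    {𝒟 : Matrix (Fin 1) (Fin 1) ℝ} {X : Matrix ι ι ℝ} (h : PassivityLMI 𝒜 ℬ 𝒞 𝒟 X) :
    ∃ ε > 0, ∀ (s : ι → ℝ) (u : ℝ),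
      (𝒜 *ᵥ s + ℬ *ᵥ fun _ => u) ⬝ᵥ X *ᵥ (𝒜 *ᵥ s + ℬ *ᵥ fun _ => u) +
        2 * ((𝒞 *ᵥ s + 𝒟 *ᵥ fun _ => u) 0 * u) + ε * (s ⬝ᵥ s) ≤ s ⬝ᵥ X *ᵥ s := by
  obtain ⟨ε, hε, hle⟩ := exists_mul_dotProduct_le h.2
  refine ⟨ε, hε, fun s u => ?_⟩
  have h1 := hle (Sum.elim s fun _ => u)
  rw [neg_mulVec, add_mulVec, dotProduct_neg, dotProduct_add, dotProduct_congruence_mulVec,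
    dotProduct_congruence_mulVec] at h1
  simp only [fromBlocks_mulVec, Function.comp_def, Sum.elim_inl, Sum.elim_inr,
    sumElim_dotProduct_sumElim, one_mulVec, zero_mulVec, add_zero, zero_add, neg_mulVec,
    dotProduct_neg] at h1
  simp only [dotProduct_fin_one] at h1
  -- The margin `ε u²` is dropped; only the state margin is needed.
  nlinarith [mul_nonneg hε.le (mul_self_nonneg u)]

/-! ### The filtered loop -/

/-- The state at time `t` of the filter `(A, B)` started at `0` and driven by `y`. -/
def filterState {l : ℕ} (A : Matrix (Fin l) (Fin l) ℝ) (B : Matrix (Fin l) (Fin 1) ℝ)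
    (y : ℕ → ℝ) (t : ℕ) : Fin l → ℝ :=
  -- As `k < t`, the subtraction never truncates.
  ∑ k ∈ Finset.range t, (A ^ k * B) *ᵥ fun _ => y (t - 1 - k)

theorem filterState_succ {l : ℕ} (A : Matrix (Fin l) (Fin l) ℝ) (B : Matrix (Fin l) (Fin 1) ℝ)
    (y : ℕ → ℝ) (t : ℕ) :
    filterState A B y (t + 1) = A *ᵥ filterState A B y t + B *ᵥ fun _ => y t := by
  rw [filterState, Finset.sum_range_succ', filterState, mulVec_sum]
  congr 1
  · refine Finset.sum_congr rfl fun k _ => ?_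
    rw [mulVec_mulVec, pow_succ', Matrix.mul_assoc]
    congr 2
    funext
    congr 1
    omega
  · simp

theorem filterState_output {l : ℕ} (A : Matrix (Fin l) (Fin l) ℝ) (B : Matrix (Fin l) (Fin 1) ℝ)
    (C : Matrix (Fin 1) (Fin l) ℝ) (D : ℝ) (y : ℕ → ℝ) (t : ℕ) :
    (C *ᵥ filterState A B y t) 0 + D * y t =
      ∑ k ∈ Finset.range (t + 1), impulse A B C D k * y (t - k) := by
  rw [Finset.sum_range_succ', filterState, mulVec_sum, Finset.sum_apply]
  congr 1
  refine Finset.sum_congr rfl fun k _ => ?_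
  rw [mulVec_mulVec, impulse]
  have h1 : t - 1 - k = t - (k + 1) := by omega
  rw [h1]
  exact dotProduct_fin_one _ _

/-- The summed dissipation inequality along one coordinate of the loop. -/
theorem exists_summed_dissipation {m L ρ : ℝ} {n l : ℕ}
    {A : Matrix (Fin n) (Fin n) ℝ} {B : Matrix (Fin n) (Fin 1) ℝ} {C : Matrix (Fin 1) (Fin n) ℝ}
    {Af : Matrix (Fin l) (Fin l) ℝ} {Bf : Matrix (Fin l) (Fin 1) ℝ} {Cf : Matrix (Fin 1) (Fin l) ℝ}
    {Df : ℝ} {X : Matrix (Fin l ⊕ Fin n) (Fin l ⊕ Fin n) ℝ}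
    (h : PassivityLMI (seriesA ρ m L Af Bf A B C) (seriesB ρ Bf B) (seriesC m L Cf Df C)
      (seriesD Df) X) :
    ∃ c > 0, ∃ ε > 0, ∃ b, ∀ (x : ℕ → Fin n → ℝ) (w z u y : ℕ → ℝ),
      (∀ t, x (t + 1) = A *ᵥ x t + B *ᵥ fun _ => w t) → (∀ t, z t = (C *ᵥ x t) 0) →
      (∀ t, u t = w t - m * z t) → (∀ t, y t = (L - m) * z t - u t) → ∀ T,
        c * (((ρ ^ T)⁻¹) ^ 2 * (x T ⬝ᵥ x T)) +
          ε * ∑ t ∈ Finset.range T, ((ρ ^ t)⁻¹) ^ 2 * (x t ⬝ᵥ x t) +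
          2 * ∑ t ∈ Finset.range T, ∑ k ∈ Finset.range (t + 1),
            impulse Af Bf Cf Df k * ((ρ ^ t)⁻¹ * (ρ ^ (t - k))⁻¹) * (u t * y (t - k)) ≤
        b * (x 0 ⬝ᵥ x 0) := by
  obtain ⟨c, hc, hcX⟩ := exists_mul_dotProduct_le h.1
  obtain ⟨b, hb⟩ := exists_dotProduct_mulVec_le X
  obtain ⟨ε, hε, hdiss⟩ := h.exists_dissipation
  refine ⟨c, hc, ε, hε, b, fun x w z u y hx hz hu hy T => ?_⟩
  set ŷ : ℕ → ℝ := fun t => (ρ ^ t)⁻¹ * y t with hŷ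
  set ξ := filterState Af Bf ŷ with hξ
  -- The weight turns the plant matrices into those scaled by `ρ⁻¹`. The filter starts at rest, so
  -- `S 0` involves only `x 0`.
  set S : ℕ → Fin l ⊕ Fin n → ℝ := fun t => Sum.elim (ξ t) ((ρ ^ t)⁻¹ • x t) with hS
  have hC : ∀ t, (C *ᵥ x t) = fun _ => z t := by
    intro t
    funext i
    rw [Subsingleton.elim i 0, hz]
  have hstep : ∀ t, S (t + 1) = seriesA ρ m L Af Bf A B C *ᵥ S t +
      seriesB ρ Bf B *ᵥ fun _ => (ρ ^ t)⁻¹ * u t := by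
    intro t
    simp only [hS, seriesA, seriesB, fromBlocks_mulVec, fromRows_mulVec, Function.comp_def,
      Sum.elim_inl, Sum.elim_inr]
    have e1 : ξ (t + 1) = Af *ᵥ ξ t + (Bf * ((L - m) • C)) *ᵥ ((ρ ^ t)⁻¹ • x t) +
        (-Bf) *ᵥ fun _ => (ρ ^ t)⁻¹ * u t := by
      rw [hξ, filterState_succ, ← mulVec_mulVec, smul_mulVec, mulVec_smul C, hC, add_assoc,
        neg_mulVec, ← sub_eq_add_neg, ← mulVec_sub]
      congr 2
      funext i
      simp only [hŷ, hy, Pi.sub_apply, Pi.smul_apply, smul_eq_mul]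
      ring
    have e2 : (ρ ^ (t + 1))⁻¹ • x (t + 1) = (0 : Matrix (Fin n) (Fin l) ℝ) *ᵥ ξ t +
        (ρ⁻¹ • (A + B * (m • C))) *ᵥ ((ρ ^ t)⁻¹ • x t) + (ρ⁻¹ • B) *ᵥ fun _ => (ρ ^ t)⁻¹ * u t := by
      rw [zero_mulVec, zero_add, smul_mulVec, add_mulVec, ← mulVec_mulVec, smul_mulVec, mulVec_smul A,
        mulVec_smul C, hC, smul_mulVec, ← smul_add, add_assoc, ← mulVec_add, hx, pow_succ', mul_inv,
        mul_smul, smul_add, ← mulVec_smul B]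
      congr 3
      funext i
      simp only [hu, Pi.add_apply, Pi.smul_apply, smul_eq_mul]
      ring
    rw [e1, e2]
    ext i
    rcases i with i | i <;> rfl
  have hout : ∀ t, (seriesC m L Cf Df C *ᵥ S t + seriesD Df *ᵥ fun _ => (ρ ^ t)⁻¹ * u t) 0 =
      ∑ k ∈ Finset.range (t + 1), impulse Af Bf Cf Df k * ŷ (t - k) := by
    intro t
    rw [← filterState_output]
    simp only [hS, seriesC, seriesD, fromCols_mulVec, Function.comp_def, Sum.elim_inl, Sum.elim_inr]
    rw [neg_mulVec, smul_mulVec, smul_mulVec, smul_mulVec, mulVec_smul, hC, one_mulVec]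
    change (Cf *ᵥ ξ t) 0 + _ + _ = (Cf *ᵥ ξ t) 0 + _
    simp only [hŷ, hy, Pi.smul_apply, Pi.neg_apply, smul_eq_mul]
    ring
  have hSsq : ∀ t, ((ρ ^ t)⁻¹) ^ 2 * (x t ⬝ᵥ x t) ≤ S t ⬝ᵥ S t := by
    intro t
    simp only [hS, sumElim_dotProduct_sumElim, smul_dotProduct, dotProduct_smul, smul_eq_mul]
    have : 0 ≤ ξ t ⬝ᵥ ξ t := Finset.sum_nonneg fun i _ => mul_self_nonneg _
    linarith
  have hsum : ∀ T, S T ⬝ᵥ X *ᵥ S T +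
      ε * ∑ t ∈ Finset.range T, ((ρ ^ t)⁻¹) ^ 2 * (x t ⬝ᵥ x t) +
      2 * ∑ t ∈ Finset.range T, ∑ k ∈ Finset.range (t + 1),
        impulse Af Bf Cf Df k * ((ρ ^ t)⁻¹ * (ρ ^ (t - k))⁻¹) * (u t * y (t - k)) ≤
      S 0 ⬝ᵥ X *ᵥ S 0 := by
    intro T
    induction T with
    | zero => simp
    | succ T ih =>
      have h1 := hdiss (S T) ((ρ ^ T)⁻¹ * u T)
      rw [← hstep, hout, Finset.sum_mul] at h1
      have h2 : ∑ k ∈ Finset.range (T + 1), impulse Af Bf Cf Df k * ŷ (T - k) *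
          ((ρ ^ T)⁻¹ * u T) = ∑ k ∈ Finset.range (T + 1),
          impulse Af Bf Cf Df k * ((ρ ^ T)⁻¹ * (ρ ^ (T - k))⁻¹) * (u T * y (T - k)) :=
        Finset.sum_congr rfl fun k _ => by simp only [hŷ]; ring
      rw [h2] at h1
      rw [Finset.sum_range_succ _ T, Finset.sum_range_succ _ T]
      have h3 := mul_le_mul_of_nonneg_left (hSsq T) hε.le
      linarith
  have h0 : S 0 ⬝ᵥ S 0 = x 0 ⬝ᵥ x 0 := by
    simp [hS, hξ, filterState]
  have h1 := hsum T
  have h2 := hcX (S T)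
  have h3 := hb (S 0)
  have h4 := mul_le_mul_of_nonneg_left (hSsq T) hc.le
  rw [h0] at h3
  linarith

/-! ### The loop -/

/-- Nonnegativity of the Zames–Falb sum along the gradient of a function in `S⁰_{m,L}`. -/
theorem MemS0.zamesFalb_nonneg {m L ρ : ℝ} (hmL : m < L) (hρ0 : 0 < ρ) (hρ1 : ρ ≤ 1) {d : ℕ}
    {f : EuclideanSpace ℝ (Fin d) → ℝ} (hf : MemS0 m L f) {h : ℕ → ℝ} (hneg : ∀ k, h (k + 1) ≤ 0)
    (hsum : ∀ N, 0 ≤ ∑ k ∈ Finset.range (N + 1), h k * (ρ ^ k)⁻¹)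
    (z u y : ℕ → EuclideanSpace ℝ (Fin d)) (hu : ∀ t, u t = gradient f (z t) - m • z t)
    (hy : ∀ t, y t = (L - m) • z t - u t) (T : ℕ) :
    0 ≤ ∑ t ∈ Finset.range T, ∑ k ∈ Finset.range (t + 1),
      h k * ((ρ ^ t)⁻¹ * (ρ ^ (t - k))⁻¹) * inner ℝ (u t) (y (t - k)) := by
  obtain ⟨hS, hf0, hg0⟩ := hf
  have hM : 0 < L - m := sub_pos.2 hmL
  have key := fun a b => storage_sub_le hM (fun y => (hS.sandwich a y).1)
    (fun y => (hS.sandwich b y).2)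
  refine zamesFalb_sum_nonneg hρ0 hρ1 (a := fun t s => inner ℝ (u t) (y s))
    (V := fun t => (L - m) * (f (z t) - m * halfSq (z t)) - 1 / 2 * ‖u t‖ ^ 2)
    (fun t => ?_) (fun t => ?_) (fun t s => ?_) hneg hsum T
  -- Comparing with the minimiser `0` of `g`, where `V`, `u` and `y` vanish, gives `V ≥ 0`; the
  -- reverse comparison gives the diagonal bound.
  · have := key 0 (z t)
    simpa [hg0, hf0, halfSq, hu] using this
  · have := key (z t) 0
    simp only [hg0, hf0, halfSq, smul_zero, sub_zero, inner_zero_right, norm_zero, ne_eq,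
      OfNat.ofNat_ne_zero, not_false_eq_true, zero_pow, mul_zero, add_zero] at this
    simp only [hy, hu, halfSq]
    linarith
  · simp only [hy, hu]
    exact key (z t) (z s)

/-- Tensoring with `I_d` decouples the linear part, so a scalar dissipation inequality serves every
`d`; only the gradient couples the coordinates. -/
theorem IsLoopTrajectory.coordinate {n d : ℕ} {A : Matrix (Fin n) (Fin n) ℝ}
    {B : Matrix (Fin n) (Fin 1) ℝ} {C : Matrix (Fin 1) (Fin n) ℝ}
    {f : EuclideanSpace ℝ (Fin d) → ℝ} {x : ℕ → EuclideanSpace ℝ (Fin n × Fin d)}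
    {w z : ℕ → EuclideanSpace ℝ (Fin d)} (h : IsLoopTrajectory A B C f x w z) (j : Fin d) :
    (∀ t, (fun i => x (t + 1) (i, j)) = A *ᵥ (fun i => x t (i, j)) + B *ᵥ fun _ => w t j) ∧
      ∀ t, z t j = (C *ᵥ fun i => x t (i, j)) 0 := by
  constructor
  · intro t
    funext i
    rw [h.state_eq t (i, j)]
    simp [mulVec, dotProduct, Fintype.sum_prod_type, kroneckerMap_apply, one_apply]
  · intro t
    rw [h.output_eq t j]
    simp [mulVec, dotProduct, Fintype.sum_prod_type, kroneckerMap_apply, one_apply]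

theorem sum_dotProduct_coordinate {n d : ℕ} (v : EuclideanSpace ℝ (Fin n × Fin d)) :
    ∑ j, (fun i => v (i, j)) ⬝ᵥ (fun i => v (i, j)) = ‖v‖ ^ 2 := by
  rw [EuclideanSpace.real_norm_sq_eq, Fintype.sum_prod_type_right]
  simp [dotProduct, sq]

end RobustOpt

/-! ### The main theorem -/

theorem theorem2 (m L : ℝ) (hm : 0 ≤ m) (hmL : m < L) (ρ : ℝ) (hρ0 : 0 < ρ) (hρ1 : ρ ≤ 1)
    (n : ℕ) (A : Matrix (Fin n) (Fin n) ℝ) (B : Matrix (Fin n) (Fin 1) ℝ)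
    (C : Matrix (Fin 1) (Fin n) ℝ)
    (l : ℕ) (α : Polynomial ℝ) (hα : RobustOpt.IsFilterPolynomial ρ l α)
    (hfeas : ∃ (X : Matrix (Fin l ⊕ Fin n) (Fin l ⊕ Fin n) ℝ) (Cf : Matrix (Fin 1) (Fin l) ℝ)
        (Df : ℝ),
      RobustOpt.FilterConstraints ρ (RobustOpt.companion l α) (RobustOpt.lastUnit l) Cf Df ∧
        RobustOpt.PassivityLMI
          (RobustOpt.seriesA ρ m L (RobustOpt.companion l α) (RobustOpt.lastUnit l) A B C)
          (RobustOpt.seriesB ρ (RobustOpt.lastUnit l) B)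
          (RobustOpt.seriesC m L Cf Df C)
          (RobustOpt.seriesD Df) X) :
    ∃ K : ℝ, ∀ (d : ℕ) (f : EuclideanSpace ℝ (Fin d) → ℝ), RobustOpt.MemS0 m L f →
      ∀ (x : ℕ → EuclideanSpace ℝ (Fin n × Fin d)) (w z : ℕ → EuclideanSpace ℝ (Fin d)),
        RobustOpt.IsLoopTrajectory A B C f x w z →
          (∀ t : ℕ, ‖x t‖ ≤ K * ρ ^ t * ‖x 0‖) ∧
            (ρ = 1 → Filter.Tendsto x Filter.atTop (𝓝 0)) := by
  obtain ⟨X, Cf, Df, hfilter, hlmi⟩ := hfeas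
  obtain ⟨c, hc, ε, hε, b, hdiss⟩ := RobustOpt.exists_summed_dissipation hlmi
  -- Both `b` and `c` depend only on `X`, hence not on `d` or `f`; the absolute value is there
  -- because `b` has no known sign.
  refine ⟨√(|b| / c), fun d f hf x w z hloop => ?_⟩
  set u : ℕ → EuclideanSpace ℝ (Fin d) := fun t => w t - m • z t with hu
  set y : ℕ → EuclideanSpace ℝ (Fin d) := fun t => (L - m) • z t - u t with hy
  have hbound : ∀ T, c * (((ρ ^ T)⁻¹) ^ 2 * ‖x T‖ ^ 2) +
      ε * ∑ t ∈ Finset.range T, ((ρ ^ t)⁻¹) ^ 2 * ‖x t‖ ^ 2 ≤ |b| * ‖x 0‖ ^ 2 := by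
    intro T
    have hzf := hf.zamesFalb_nonneg hmL hρ0 hρ1
      (RobustOpt.impulse_succ_nonpos hα (D := Df) hfilter.1)
      (RobustOpt.sum_impulse_nonneg hα hρ0 hfilter) z u y
      (fun t => by rw [hu, ← hloop.feedback_eq]) (fun t => rfl) T
    -- The supply of a single coordinate need not have a sign; summing over `j` produces the inner
    -- products of the Zames–Falb sum.
    have hj := Finset.sum_le_sum fun (j : Fin d) (_ : j ∈ Finset.univ) =>
      hdiss (fun t i => x t (i, j)) (fun t => w t j) (fun t => z t j) (fun t => u t j)
        (fun t => y t j) (hloop.coordinate j).1 (hloop.coordinate j).2 (fun t => by simp [hu])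
        (fun t => by simp [hy]) T
    simp only [Finset.sum_add_distrib, ← Finset.mul_sum] at hj
    rw [Finset.sum_comm (s := Finset.univ), Finset.sum_comm (s := Finset.univ)] at hj
    simp only [Finset.sum_comm (s := (Finset.univ : Finset (Fin d))) (t := Finset.range _),
      ← Finset.mul_sum, RobustOpt.sum_dotProduct_coordinate] at hj
    have hin : ∀ t s, ∑ j, u t j * y s j = inner ℝ (u t) (y s) := by
      intro t s
      simp [PiLp.inner_apply, mul_comm]
    simp only [hin] at hj
    have := mul_le_mul_of_nonneg_right (le_abs_self b) (sq_nonneg ‖x 0‖)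
    linarith
  constructor
  · intro T
    have h1 : c * (((ρ ^ T)⁻¹) ^ 2 * ‖x T‖ ^ 2) ≤ |b| * ‖x 0‖ ^ 2 := by
      refine le_trans ?_ (hbound T)
      exact le_add_of_nonneg_right (mul_nonneg hε.le (Finset.sum_nonneg fun t _ => by positivity))
    have h2 : ‖x T‖ ^ 2 ≤ (√(|b| / c) * ρ ^ T * ‖x 0‖) ^ 2 := by
      rw [mul_pow, mul_pow, Real.sq_sqrt (by positivity)]
      have hp : 0 < (ρ ^ T) ^ 2 := by positivity
      rw [inv_pow, ← div_eq_inv_mul, mul_div_assoc', div_le_iff₀ hp, mul_comm c,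
        ← le_div_iff₀ hc] at h1
      calc _ ≤ _ := h1
        _ = _ := by ring
    exact le_of_sq_le_sq h2 (by positivity)
  · rintro rfl
    -- For `ρ = 1` the strictness margin `ε` yields square summability, hence convergence to `0`.
    have hsum : Summable fun t => ‖x t‖ ^ 2 := by
      refine summable_of_sum_range_le (c := |b| * ‖x 0‖ ^ 2 / ε) (fun t => sq_nonneg _) fun T => ?_
      rw [le_div_iff₀ hε, mul_comm]
      have h1 := hbound T
      simp only [one_pow, inv_one, one_mul] at h1
      have : 0 ≤ c * ‖x T‖ ^ 2 := by positivity
      linarith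
    have h0 := hsum.tendsto_atTop_zero
    rw [tendsto_zero_iff_norm_tendsto_zero]
    simpa [Function.comp_def, Real.sqrt_sq] using (Real.continuous_sqrt.tendsto 0).comp h0
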